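/- Let $U,\tilde U\subseteq\mathbb R^2$ be open neighbourhoods of the origin, and let $\mathfrak g$ and $\tilde{\mathfrak g}$ be $3$-dimensional real Lie algebras (under the commutator of vector fields) of $C^\infty$ vector fields on $U$ and on $\tilde U$, respectively. Let $\mathfrak g_0=\{X\in\mathfrak g : X(0)=0\}$ and $\tilde{\mathfrak g}_0=\{X\in\tilde{\mathfrak g} : X(0)=0\}$ be their isotropy subalgebras at the origin. Assume that both Lie algebras are transitive at the origin, i.e. $\dim\mathfrak g_0=\dim\tilde{\mathfrak g}_0=1$, and that no nonzero element of $\mathfrak g$ or of $\tilde{\mathfrak g}$ vanishes identically on a neighbourhood of the origin. Then: 1. The following two conditions are equivalent: (a) there is a $C^\infty$ diffeomorphism $\varphi:W\to\tilde W$ between open neighbourhoods $W\subseteq U$ and $\tilde W\subseteq\tilde U$ of the origin, with $\varphi(0)=0$, such that for every $X\in\mathfrak g$ there is a $Y\in\tilde{\mathfrak g}$ with $\varphi_*(X|_W)=Y|_{\tilde W}$; (b) there is an isomorphism of Lie algebras $\psi:\mathfrak g\to\tilde{\mathfrak g}$ with $\psi(\mathfrak g_0)=\tilde{\mathfrak g}_0$.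 2. $\mathfrak g_0$ is not an ideal of $\mathfrak g$, i.e. there is an $X\in\mathfrak g$ with $[X,\mathfrak g_0]\not\subseteq\mathfrak g_0$; likewise $\tilde{\mathfrak g}_0$ is not an ideal of $\tilde{\mathfrak g}$. -/

import Mathlib

open scoped ContDiff Topology

noncomputable section

namespace PlaneVF

/-- The plane `ℝ²` with its coordinates `(x, y)`; the origin is `0`. -/
abbrev Plane : Type := ℝ × ℝ

/-- The real vector space of `C^∞` vector fields on the open set `U ⊆ ℝ²`. A vector field on `U` is
encoded by its extension by zero to the whole plane, so that two of them are equal if and only if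
they agree on `U`; nothing is assumed about the behaviour at the boundary of `U`. -/
def smoothVectorFields (U : TopologicalSpace.Opens Plane) : Submodule ℝ (Plane → Plane) where
  carrier := {X | ContDiffOn ℝ ∞ X U ∧ ∀ p ∉ U, X p = 0}
  zero_mem' := ⟨contDiffOn_const, fun _ _ => rfl⟩
  add_mem' := by
    rintro X Y ⟨hX, hX'⟩ ⟨hY, hY'⟩
    exact ⟨hX.add hY, fun p hp => by simp [hX' p hp, hY' p hp]⟩
  smul_mem' := by
    rintro c X ⟨hX, hX'⟩
    exact ⟨contDiffOn_const.smul hX, fun p hp => by simp [hX' p hp]⟩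

/-- The type of `C^∞` vector fields on the open set `U ⊆ ℝ²`. -/
def VectorFieldOn (U : TopologicalSpace.Opens Plane) : Type := ↥(smoothVectorFields U)

variable {U : TopologicalSpace.Opens Plane}

instance : AddCommGroup (VectorFieldOn U) := inferInstanceAs (AddCommGroup (smoothVectorFields U))

instance : Module ℝ (VectorFieldOn U) := inferInstanceAs (Module ℝ (smoothVectorFields U))

/-- The value of a vector field on `U` at a point of the plane (zero outside `U`). -/
@[coe]
def VectorFieldOn.toFun (X : VectorFieldOn U) : Plane → Plane := Subtype.val X

instance : CoeFun (VectorFieldOn U) fun _ => Plane → Plane := ⟨VectorFieldOn.toFun⟩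

theorem VectorFieldOn.contDiffOn (X : VectorFieldOn U) : ContDiffOn ℝ ∞ X U := X.property.1

theorem VectorFieldOn.apply_of_notMem (X : VectorFieldOn U) {p : Plane} (hp : p ∉ U) : X p = 0 :=
  X.property.2 p hp

theorem VectorFieldOn.zero_apply (p : Plane) : (0 : VectorFieldOn U) p = 0 := rfl

theorem VectorFieldOn.add_apply (X Y : VectorFieldOn U) (p : Plane) : (X + Y) p = X p + Y p := rfl

theorem VectorFieldOn.smul_apply (c : ℝ) (X : VectorFieldOn U) (p : Plane) :
    (c • X) p = c • X p := rfl

theorem VectorFieldOn.contDiffAt (X : VectorFieldOn U) {p : Plane} (hp : p ∈ U) :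
    ContDiffAt ℝ ∞ X p :=
  X.contDiffOn.contDiffAt (U.isOpen.mem_nhds hp)

theorem VectorFieldOn.differentiableAt (X : VectorFieldOn U) {p : Plane} (hp : p ∈ U) :
    DifferentiableAt ℝ X p :=
  (X.contDiffAt hp).differentiableAt (by simp)

theorem VectorFieldOn.ext_on {X Y : VectorFieldOn U} (h : ∀ p ∈ U, X p = Y p) : X = Y := by
  apply Subtype.ext
  funext p
  by_cases hp : p ∈ U
  · exact h p hp
  · exact (X.apply_of_notMem hp).trans (Y.apply_of_notMem hp).symm

open Classical in
/-- The commutator of vector fields on `U`: at `p ∈ U` it is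
`[X, Y](p) = DY(p) X(p) - DX(p) Y(p)`. -/
instance : Bracket (VectorFieldOn U) (VectorFieldOn U) where
  bracket X Y := ⟨fun p => if p ∈ U then VectorField.lieBracket ℝ X Y p else 0, by
    refine ⟨?_, fun p hp => if_neg hp⟩
    have h : ContDiffOn ℝ ∞ (VectorField.lieBracket ℝ X Y) U := fun p hp =>
      ((X.contDiffAt hp).lieBracket_vectorField (Y.contDiffAt hp) (by simp)).contDiffWithinAt
    exact h.congr fun p hp => if_pos hp⟩

theorem VectorFieldOn.bracket_apply (X Y : VectorFieldOn U) {p : Plane} (hp : p ∈ U) :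
    (⁅X, Y⁆ : VectorFieldOn U) p = fderiv ℝ Y p (X p) - fderiv ℝ X p (Y p) :=
  if_pos hp

theorem VectorFieldOn.bracket_eventuallyEq (X Y : VectorFieldOn U) {p : Plane} (hp : p ∈ U) :
    (⁅X, Y⁆ : VectorFieldOn U) =ᶠ[𝓝 p] VectorField.lieBracket ℝ X Y := by
  filter_upwards [U.isOpen.mem_nhds hp] with q hq
  exact if_pos hq

/-- The `C^∞` vector fields on `U` form a Lie ring under the commutator. -/
instance : LieRing (VectorFieldOn U) where
  add_lie X Y Z := VectorFieldOn.ext_on fun p hp => by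
    have h : fderiv ℝ (X + Y : VectorFieldOn U) p = fderiv ℝ X p + fderiv ℝ Y p :=
      fderiv_add (X.differentiableAt hp) (Y.differentiableAt hp)
    simp only [VectorFieldOn.add_apply, VectorFieldOn.bracket_apply _ _ hp, h, map_add,
      _root_.add_apply]
    abel
  lie_add X Y Z := VectorFieldOn.ext_on fun p hp => by
    have h : fderiv ℝ (Y + Z : VectorFieldOn U) p = fderiv ℝ Y p + fderiv ℝ Z p :=
      fderiv_add (Y.differentiableAt hp) (Z.differentiableAt hp)
    simp only [VectorFieldOn.add_apply, VectorFieldOn.bracket_apply _ _ hp, h, map_add,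
      _root_.add_apply]
    abel
  lie_self X := VectorFieldOn.ext_on fun p hp => by
    rw [VectorFieldOn.bracket_apply _ _ hp, sub_self]
    rfl
  leibniz_lie X Y Z := VectorFieldOn.ext_on fun p hp => by
    have hs : minSmoothness ℝ 2 ≤ (∞ : WithTop ℕ∞) := by
      rw [minSmoothness_of_isRCLikeNormedField]
      exact WithTop.coe_le_coe.2 le_top
    have e := VectorField.leibniz_identity_lieBracket (𝕜 := ℝ) hs
      (X.contDiffAt hp) (Y.contDiffAt hp) (Z.contDiffAt hp)
    rw [VectorFieldOn.add_apply,
      (VectorFieldOn.bracket_eventuallyEq X ⁅Y, Z⁆ hp).eq_of_nhds,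
      (VectorFieldOn.bracket_eventuallyEq ⁅X, Y⁆ Z hp).eq_of_nhds,
      (VectorFieldOn.bracket_eventuallyEq Y ⁅X, Z⁆ hp).eq_of_nhds,
      (Filter.EventuallyEq.refl _ X).lieBracket_vectorField_eq
        (VectorFieldOn.bracket_eventuallyEq Y Z hp),
      (VectorFieldOn.bracket_eventuallyEq X Y hp).lieBracket_vectorField_eq
        (Filter.EventuallyEq.refl _ Z),
      (Filter.EventuallyEq.refl _ Y).lieBracket_vectorField_eq
        (VectorFieldOn.bracket_eventuallyEq X Z hp)]
    exact e

/-- The `C^∞` vector fields on `U` form a real Lie algebra under the commutator. -/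
instance : LieAlgebra ℝ (VectorFieldOn U) where
  lie_smul c X Y := VectorFieldOn.ext_on fun p hp => by
    have h : fderiv ℝ (c • Y : VectorFieldOn U) p = c • fderiv ℝ Y p :=
      fderiv_const_smul (Y.differentiableAt hp) c
    simp only [VectorFieldOn.smul_apply, VectorFieldOn.bracket_apply _ _ hp, h, map_smul, smul_sub,
      _root_.smul_apply]

/-- The isotropy subalgebra `𝔤₀ = {X ∈ 𝔤 | X(0) = 0}` at the origin, as a subalgebra of `𝔤`. -/
def isotropy (h0 : (0 : Plane) ∈ U) (g : LieSubalgebra ℝ (VectorFieldOn U)) :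
    LieSubalgebra ℝ g where
  carrier := {X | X.1 0 = 0}
  zero_mem' := rfl
  add_mem' := by
    intro X Y (hX : X.1 0 = 0) (hY : Y.1 0 = 0)
    change X.1 0 + Y.1 0 = 0
    rw [hX, hY, add_zero]
  smul_mem' := by
    intro c X (hX : X.1 0 = 0)
    change c • X.1 0 = 0
    rw [hX, smul_zero]
  lie_mem' := by
    intro X Y (hX : X.1 0 = 0) (hY : Y.1 0 = 0)
    change (⁅X.1, Y.1⁆ : VectorFieldOn U) 0 = 0
    rw [VectorFieldOn.bracket_apply _ _ h0, hX, hY, map_zero, map_zero, sub_zero]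

/-- A three-dimensional Lie algebra `𝔤` of vector fields on `U ∋ 0` is transitive at the origin:
`dim 𝔤₀ = 1` (so the values `X(0)`, `X ∈ 𝔤`, fill the two-dimensional tangent plane at `0`), and no
nonzero `X ∈ 𝔤` vanishes identically near the origin. -/
structure IsTransitive3 (h0 : (0 : Plane) ∈ U) (g : LieSubalgebra ℝ (VectorFieldOn U)) : Prop where
  finrank_eq : Module.finrank ℝ g = 3
  finrank_isotropy : Module.finrank ℝ (isotropy h0 g) = 1
  eq_zero_of_eventually : ∀ X ∈ g, (∀ᶠ p in 𝓝 (0 : Plane), X p = 0) → X = 0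

/-- `φ` is a local coordinate transformation fixing the origin: a `C^∞` diffeomorphism with `C^∞`
inverse from the open neighbourhood `φ.source ⊆ U` of `0` onto the open neighbourhood
`φ.target ⊆ V` of `0`, with `φ 0 = 0`. -/
structure IsLocalDiffeoFixingOrigin (U V : TopologicalSpace.Opens Plane)
    (φ : OpenPartialHomeomorph Plane Plane) : Prop where
  zero_mem_source : (0 : Plane) ∈ φ.source
  map_zero : φ 0 = 0
  source_subset : φ.source ⊆ U
  target_subset : φ.target ⊆ V
  contDiffOn : ContDiffOn ℝ ∞ φ φ.source
  contDiffOn_symm : ContDiffOn ℝ ∞ φ.symm φ.target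

/-- `φ` takes `X` to `Y`: the push-forward of `X` restricted to `φ.source` is `Y` restricted to
`φ.target`, i.e. `Dφ(p) X(p) = Y(φ(p))` for all `p ∈ φ.source`. -/
def PushesTo {U V : TopologicalSpace.Opens Plane} (φ : OpenPartialHomeomorph Plane Plane)
    (X : VectorFieldOn U) (Y : VectorFieldOn V) : Prop :=
  ∀ p ∈ φ.source, fderiv ℝ φ p (X p) = Y (φ p)

end PlaneVF

end

noncomputable section

namespace PlaneVF

/-! From a diffeomorphism to an isomorphism: the push-forward of `X` is unique in the second
algebra, since only zero vanishes near the origin there. It therefore defines a Lie homomorphism,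
injective because `Dφ` is, hence bijective since both dimensions are 3. It respects isotropy because
`φ` fixes the origin.

The converse solves a total differential equation. Choose `σ` with `(σ c)(0) = c`; near the origin
the fields `σ c` form a frame, and so do their images under `ψ`. A diffeomorphism realizing `ψ` must
carry one frame to the other, so `Dφ(p) = F(p, φ(p))` with `F` the `transport` map. This `F` need
not be integrable in the sense of Frobenius on all of `ℝ² × ℝ²`, because the two-dimensional range
of `σ` need not be closed under brackets. It is integrable at the points where the `defect` of every
`w`, the failure of `F` to carry `w` to `ψ w`, is zero (`integrableAt_transport`). Along a solution
over a ray the defects satisfy linear equations (`hasDerivAt_defect`), and all are multiples of the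
defect of one generator `e` of the isotropy. That one starts at zero because `ψ` preserves isotropy,
so it stays zero (`IsSplitting.defect_eq_zero`). Integrability along the rays suffices to solve the
system (`exists_hasFDerivAt_of_integrableAt`), and vanishing of the defects says that the solution
realizes `ψ`.

For the second claim: if the isotropy were an ideal, `e` would satisfy a linear equation along rays
with initial value zero, so it would vanish near the origin. -/

/-- The confinement to the ball is part of the fixed-point construction. It is kept because the
later estimates need a bound on solutions that is linear in the ray direction. -/
theorem _root_.IsPicardLindelof.exists_hasDerivWithinAt_mem_closedBall {G : Type*}
    [NormedAddCommGroup G] [NormedSpace ℝ G] [CompleteSpace G] {f : ℝ → G → G} {tmin tmax : ℝ}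
    {t₀ : Set.Icc tmin tmax} {x₀ : G} {a L K : NNReal} (hf : IsPicardLindelof f t₀ x₀ a 0 L K) :
    ∃ α : ℝ → G, α t₀ = x₀ ∧
      (∀ t ∈ Set.Icc tmin tmax, HasDerivWithinAt α (f t (α t)) (Set.Icc tmin tmax) t) ∧
      ∀ t, α t ∈ Metric.closedBall x₀ a := by
  have hx : x₀ ∈ Metric.closedBall x₀ ((0 : NNReal) : ℝ) := Metric.mem_closedBall_self le_rfl
  obtain ⟨α, hα⟩ := ODE.FunSpace.exists_isFixedPt_next hf hx
  refine ⟨α.compProj, by rw [ODE.FunSpace.compProj_val, ← hα, ODE.FunSpace.next_apply₀],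
    fun t ht => ?_, fun t => α.compProj_mem_closedBall hf.mul_max_le⟩
  apply ODE.hasDerivWithinAt_picard_Icc t₀.2 hf.continuousOn_uncurry
    α.continuous_compProj.continuousOn (fun _ _ => α.compProj_mem_closedBall hf.mul_max_le)
    x₀ ht |>.congr_of_mem _ ht
  intro t' ht'
  nth_rw 1 [← hα]
  rw [ODE.FunSpace.compProj_of_mem ht', ODE.FunSpace.next_apply]

/-! ### Total differential systems solved along rays -/

section TotalDifferential

open Set Metric

variable {E G : Type*} [NormedAddCommGroup E] [NormedSpace ℝ E]
  [NormedAddCommGroup G] [NormedSpace ℝ G]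

/-- A solution of the ray equation `q' = F(r p, q) p` on `[0, 1]`, starting at `0`. -/
def IsRaySolution (F : E × G → E →L[ℝ] G) (p : E) (q : ℝ → G) : Prop :=
  q 0 = 0 ∧ ∀ r ∈ Icc (0 : ℝ) 1, HasDerivAt q (F (r • p, q r) p) r

/-- Symmetry at `z` of the derivative of `F` along its own graph: the pointwise Frobenius condition
of the total differential system `Dφ(p) = F(p, φ(p))`. -/
def IntegrableAt (F : E × G → E →L[ℝ] G) (z : E × G) : Prop :=
  ∀ u v : E, fderiv ℝ F z (u, F z u) v = fderiv ℝ F z (v, F z v) u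

/-- Uniform bounds for `F` on the ball of radius `ρ` around the origin. -/
structure BoundedOnBall (F : E × G → E →L[ℝ] G) (ρ L : ℝ) : Prop where
  pos : 0 < ρ
  one_le : 1 ≤ L
  differentiableAt : ∀ z ∈ ball (0 : E × G) ρ, DifferentiableAt ℝ F z
  norm_le : ∀ z ∈ ball (0 : E × G) ρ, ‖F z‖ ≤ L
  norm_fderiv_le : ∀ z ∈ ball (0 : E × G) ρ, ‖fderiv ℝ F z‖ ≤ L
  norm_fderiv_sub_le : ∀ z ∈ ball (0 : E × G) ρ, ∀ w ∈ ball (0 : E × G) ρ,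
    ‖fderiv ℝ F w - fderiv ℝ F z‖ ≤ L * ‖w - z‖

theorem exists_boundedOnBall {F : E × G → E →L[ℝ] G} (hF : ContDiffAt ℝ 2 F 0) :
    ∃ ρ L, BoundedOnBall F ρ L := by
  have hF' : ContDiffAt ℝ 1 (fderiv ℝ F) 0 := hF.fderiv_right (by norm_num)
  obtain ⟨K, t, ht, hK⟩ := hF'.exists_lipschitzOnWith
  have h1 : ∀ᶠ z in 𝓝 (0 : E × G), DifferentiableAt ℝ F z := by
    filter_upwards [hF.eventually (by simp)] with z hz using hz.differentiableAt (by simp)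
  have h2 : ∀ᶠ z in 𝓝 (0 : E × G), ‖F z‖ < ‖F 0‖ + 1 :=
    hF.continuousAt.norm.eventually (gt_mem_nhds (lt_add_one _))
  have h3 : ∀ᶠ z in 𝓝 (0 : E × G), ‖fderiv ℝ F z‖ < ‖fderiv ℝ F 0‖ + 1 :=
    (ContinuousAt.norm (f := fderiv ℝ F) hF'.continuousAt).eventually_lt_const (lt_add_one _)
  obtain ⟨ρ, hρ, hb⟩ := Metric.eventually_nhds_iff_ball.1 (h1.and (h2.and (h3.and ht)))
  have hK0 : (0 : ℝ) ≤ K := K.2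
  refine ⟨ρ, ‖F 0‖ + ‖fderiv ℝ F 0‖ + K + 1, hρ, ?_, fun z hz => (hb z hz).1, fun z hz => ?_,
    fun z hz => ?_, fun z hz w hw => ?_⟩
  · linarith [norm_nonneg (F 0), norm_nonneg (fderiv ℝ F 0)]
  · linarith [norm_nonneg (F 0), norm_nonneg (fderiv ℝ F 0), (hb z hz).2.1]
  · linarith [norm_nonneg (F 0), norm_nonneg (fderiv ℝ F 0), (hb z hz).2.2.1]
  · refine (hK.norm_sub_le (hb w hw).2.2.2 (hb z hz).2.2.2).trans ?_
    gcongr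
    linarith [norm_nonneg (F 0), norm_nonneg (fderiv ℝ F 0)]

namespace BoundedOnBall

variable {F : E × G → E →L[ℝ] G} {ρ L : ℝ}

theorem lipschitzOnWith (h : BoundedOnBall F ρ L) :
    LipschitzOnWith L.toNNReal F (ball 0 ρ) := by
  refine (convex_ball _ _).lipschitzOnWith_of_nnnorm_fderiv_le h.differentiableAt fun z hz => ?_
  rw [← NNReal.coe_le_coe, Real.coe_toNNReal _ (zero_le_one.trans h.one_le)]
  exact h.norm_fderiv_le z hz

theorem lipschitzOnWith_apply (h : BoundedOnBall F ρ L) {x p : E} (hx : ‖x‖ < ρ) (hp : ‖p‖ ≤ 1) :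
    LipschitzOnWith L.toNNReal (fun y => F (x, y) p) (ball 0 ρ) := by
  have hL : 0 ≤ L := zero_le_one.trans h.one_le
  refine LipschitzOnWith.of_dist_le_mul fun y hy y' hy' => ?_
  have hm : ∀ y ∈ ball (0 : G) ρ, (x, y) ∈ ball (0 : E × G) ρ := fun y hy => by
    rw [mem_ball_zero_iff] at hy ⊢
    exact max_lt hx hy
  have h1 := h.lipschitzOnWith.norm_sub_le (hm y hy) (hm y' hy')
  rw [Real.coe_toNNReal _ hL] at h1
  rw [dist_eq_norm, dist_eq_norm, Real.coe_toNNReal _ hL, ← sub_apply]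
  calc ‖(F (x, y) - F (x, y')) p‖ ≤ ‖F (x, y) - F (x, y')‖ * ‖p‖ :=
        ContinuousLinearMap.le_opNorm _ _
    _ ≤ (L * ‖(x, y) - (x, y')‖) * 1 := by gcongr
    _ = L * ‖y - y'‖ := by simp [Prod.norm_def]

/-- Mean value inequality for `F` minus its linearization at `z`: on the segment the derivative
differs from that at `z` by at most `L * ‖w‖`. -/
theorem norm_taylor_le (h : BoundedOnBall F ρ L) {z w : E × G} (hz : z ∈ ball 0 ρ)
    (hw : z + w ∈ ball 0 ρ) : ‖F (z + w) - F z - fderiv ℝ F z w‖ ≤ L * ‖w‖ * ‖w‖ := by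
  have hL : 0 ≤ L := zero_le_one.trans h.one_le
  have hs : segment ℝ z (z + w) ⊆ ball 0 ρ := (convex_ball _ _).segment_subset hz hw
  have := (convex_segment z (z + w)).norm_image_sub_le_of_norm_hasFDerivWithin_le'
    (f := F) (f' := fderiv ℝ F) (φ := fderiv ℝ F z) (C := L * ‖w‖)
    (fun x hx => (h.differentiableAt x (hs hx)).hasFDerivAt.hasFDerivWithinAt)
    (fun x hx => ?_) (left_mem_segment ℝ _ _) (right_mem_segment ℝ _ _)
  · simpa using this
  · refine (h.norm_fderiv_sub_le z hz x (hs hx)).trans ?_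
    gcongr
    simpa using norm_sub_le_of_mem_segment hx

theorem exists_isRaySolution [CompleteSpace G] (h : BoundedOnBall F ρ L) {p : E}
    (hp : 2 * L * ‖p‖ < ρ) (hp1 : ‖p‖ ≤ 1) :
    ∃ q, IsRaySolution F p q ∧ ∀ r ∈ Icc (0 : ℝ) 1, ‖q r‖ ≤ 2 * L * ‖p‖ := by
  have hL : 0 ≤ L := zero_le_one.trans h.one_le
  have hr : ∀ r ∈ Icc (-1 : ℝ) 2, ‖r • p‖ < ρ := fun r hr => by
    rw [norm_smul, Real.norm_eq_abs]
    have : |r| ≤ 2 := abs_le.2 ⟨by linarith [hr.1], hr.2⟩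
    nlinarith [norm_nonneg p, h.one_le]
  have hsub : closedBall (0 : G) (2 * L * ‖p‖) ⊆ ball 0 ρ := closedBall_subset_ball hp
  have hm : ∀ r ∈ Icc (-1 : ℝ) 2, ∀ y ∈ ball (0 : G) ρ, (r • p, y) ∈ ball (0 : E × G) ρ :=
    fun r h1 y hy => by
      rw [mem_ball_zero_iff] at hy ⊢
      exact max_lt (hr r h1) hy
  -- The time interval exceeds `[0, 1]` so that derivatives at both ends are two-sided. The speed is
  -- at most `L * ‖p‖` and the time elapsed from `0` at most 2, whence the radius `2 * L * ‖p‖`.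
  have hPL : IsPicardLindelof (fun r y => F (r • p, y) p) (tmin := -1) (tmax := 2)
      ⟨0, by norm_num, by norm_num⟩ (0 : G) ⟨2 * L * ‖p‖, by positivity⟩ 0
      ⟨L * ‖p‖, by positivity⟩ L.toNNReal := by
    refine ⟨fun r h1 => ?_, fun y hy => ?_, fun r h1 y hy => ?_, ?_⟩
    · exact (h.lipschitzOnWith_apply (hr r h1) hp1).mono hsub
    · intro r h1
      have h2 : ContinuousAt F (r • p, y) :=
        (h.differentiableAt _ (hm r h1 y (hsub hy))).continuousAt
      have h3 : ContinuousAt (fun s : ℝ => (s • p, y)) r := by fun_prop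
      exact ((ContinuousAt.comp (f := fun s : ℝ => (s • p, y)) h2 h3).clm_apply
        continuousAt_const).continuousWithinAt
    · refine (ContinuousLinearMap.le_opNorm _ _).trans ?_
      exact mul_le_mul_of_nonneg_right (h.norm_le _ (hm r h1 y (hsub hy))) (norm_nonneg p)
    · change L * ‖p‖ * max (2 - 0) (0 - -1) ≤ 2 * L * ‖p‖ - 0
      norm_num
      linarith [hL]
  obtain ⟨α, h0, hder, hmem⟩ := hPL.exists_hasDerivWithinAt_mem_closedBall
  exact ⟨α, ⟨h0, fun r hr' => (hder r ⟨by linarith [hr'.1], by linarith [hr'.2]⟩).hasDerivAt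
      (Icc_mem_nhds (by linarith [hr'.1]) (by linarith [hr'.2]))⟩,
    fun r _ => mem_closedBall_zero_iff.1 (hmem r)⟩

/-- Frobenius, pointwise: if the system is integrable along the ray solution `q p`, then the value
at time one of the family `q` of ray solutions has derivative `F` at `p`. -/
theorem hasFDerivAt_of_isRaySolution (h : BoundedOnBall F ρ L) {q : E → ℝ → G} {p : E}
    (hp : 2 * L * ‖p‖ < ρ) (hp1 : ‖p‖ < 1)
    (hq : ∀ᶠ x in 𝓝 p, IsRaySolution F x (q x) ∧ ∀ r ∈ Icc (0 : ℝ) 1, ‖q x r‖ ≤ 2 * L * ‖x‖)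
    (hI : ∀ r ∈ Icc (0 : ℝ) 1, IntegrableAt F (r • p, q p r)) :
    HasFDerivAt (fun x => q x 1) (F (p, q p 1)) p := by
  have hL : 0 ≤ L := zero_le_one.trans h.one_le
  obtain ⟨⟨hq0, hqd⟩, hqn⟩ := hq.self_of_nhds
  -- A quadratic error bound gives differentiability. With zero initial error the Grönwall bound is
  -- linear in the rate, so `‖x - p‖ ^ 2` factors out.
  have key : ∀ᶠ x in 𝓝 p, ‖q x 1 - q p 1 - F (p, q p 1) (x - p)‖ ≤
      gronwallBound 0 L (L * L + L * L * L) 1 * ‖x - p‖ ^ 2 := by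
    have e1 : ∀ᶠ x in 𝓝 p, 2 * L * ‖x‖ < ρ :=
      (Continuous.continuousAt (by fun_prop)).eventually_lt_const hp
    have e2 : ∀ᶠ x in 𝓝 p, 2 * L * ‖p‖ + L * ‖x - p‖ < ρ :=
      (Continuous.continuousAt (by fun_prop)).eventually_lt_const (by simpa using hp)
    have e3 : ∀ᶠ x in 𝓝 p, ‖x‖ < 1 := continuous_norm.continuousAt.eventually_lt_const hp1
    filter_upwards [hq, e1, e2, e3] with x hx hx1 hx2 hx3
    obtain ⟨⟨hx0, hxd⟩, hxn⟩ := hx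
    obtain ⟨v, rfl⟩ : ∃ v, x = p + v := ⟨x - p, by abel⟩
    rw [add_sub_cancel_left] at hx2 ⊢
    have hmem : ∀ r ∈ Icc (0 : ℝ) 1, (r • p, q p r) ∈ ball (0 : E × G) ρ := fun r hr => by
      rw [mem_ball_zero_iff]
      refine max_lt ?_ ((hqn r hr).trans_lt hp)
      rw [norm_smul, Real.norm_of_nonneg hr.1]
      nlinarith [norm_nonneg p, h.one_le, hr.2]
    have hray : ∀ r ∈ Icc (0 : ℝ) 1, ‖r • (p + v)‖ < ρ := fun r hr => by
      rw [norm_smul, Real.norm_of_nonneg hr.1]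
      nlinarith [norm_nonneg (p + v), h.one_le, hr.2]
    have hFv : ∀ r ∈ Icc (0 : ℝ) 1, ‖r • F (r • p, q p r) v‖ ≤ L * ‖v‖ := fun r hr => by
      rw [norm_smul, Real.norm_of_nonneg hr.1]
      have := (F (r • p, q p r)).le_of_opNorm_le (h.norm_le _ (hmem r hr)) v
      nlinarith [norm_nonneg (F (r • p, q p r) v), hr.1, hr.2]
    have hmem' : ∀ r ∈ Icc (0 : ℝ) 1, q p r + r • F (r • p, q p r) v ∈ ball (0 : G) ρ :=
      fun r hr => by
        rw [mem_ball_zero_iff]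
        exact ((norm_add_le _ _).trans (add_le_add (hqn r hr) (hFv r hr))).trans_lt hx2
    have hcurve : ∀ r ∈ Icc (0 : ℝ) 1, HasDerivAt (fun s => F (s • p, q p s) v)
        (fderiv ℝ F (r • p, q p r) (p, F (r • p, q p r) p) v) r := fun r hr => by
      have h1 : HasDerivAt (fun s : ℝ => (s • p, q p s)) (p, F (r • p, q p r) p) r := by
        simpa using ((hasDerivAt_id r).smul_const p).prodMk (hqd r hr)
      have h2 := (h.differentiableAt _ (hmem r hr)).hasFDerivAt.comp_hasDerivAt r h1
      simpa using h2.clm_apply (hasDerivAt_const r v)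
    -- The trial curve is the first-order guess for the solution over the ray of `p + v`: a `φ` with
    -- derivative `F` would satisfy `φ(s(p + v)) ≈ φ(sp) + s F(sp, φ(sp)) v`.
    have happrox : ∀ r ∈ Icc (0 : ℝ) 1, HasDerivAt (fun s => q p s + s • F (s • p, q p s) v)
        (F (r • p, q p r) p + (r • fderiv ℝ F (r • p, q p r) (p, F (r • p, q p r) p) v +
          F (r • p, q p r) v)) r := fun r hr => by
      have := (hqd r hr).add ((hasDerivAt_id r).smul (hcurve r hr))
      simpa using! this
    have hIco : ∀ r ∈ Ico (0 : ℝ) 1, r ∈ Icc (0 : ℝ) 1 := fun r hr => ⟨hr.1, hr.2.le⟩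
    have hgr := dist_le_of_approx_trajectories_ODE_of_mem (a := 0) (b := 1) (δ := 0)
      (v := fun r y => F (r • (p + v), y) (p + v)) (s := fun _ => ball 0 ρ) (K := L.toNNReal)
      (f := q (p + v)) (g := fun s => q p s + s • F (s • p, q p s) v)
      (εf := 0) (εg := (L * L + L * L * L) * ‖v‖ ^ 2)
      (fun r hr => h.lipschitzOnWith_apply (hray r (hIco r hr)) hx3.le)
      (fun r hr => (hxd r hr).continuousAt.continuousWithinAt)
      (fun r hr => (hxd r (hIco r hr)).hasDerivWithinAt)
      (fun r hr => by rw [dist_self])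
      (fun r hr => mem_ball_zero_iff.2 ((hxn r (hIco r hr)).trans_lt hx1))
      (fun r hr => (happrox r hr).continuousAt.continuousWithinAt)
      (fun r hr => (happrox r (hIco r hr)).hasDerivWithinAt)
      (fun r hr => ?_) (fun r hr => hmem' r (hIco r hr)) (by simp [hx0, hq0]) 1
      (right_mem_Icc.2 zero_le_one)
    · rw [dist_eq_norm, Real.coe_toNNReal _ hL] at hgr
      refine le_trans (le_of_eq ?_) (hgr.trans (le_of_eq ?_))
      · congr 1
        simp only [one_smul]
        abel
      · have hL' : L ≠ 0 := by linarith [h.one_le]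
        simp only [gronwallBound, if_neg hL', sub_zero, zero_add, zero_mul]
        ring
    · replace hr := hIco r hr
      set z : E × G := (r • p, q p r) with hz
      set w : E × G := (r • v, r • F z v) with hw
      have hzw : (r • (p + v), q p r + r • F z v) = z + w := by
        rw [hz, hw, Prod.mk_add_mk, smul_add]
      have hzw' : z + w ∈ ball (0 : E × G) ρ := by
        rw [← hzw, mem_ball_zero_iff]
        exact max_lt (hray r hr) (mem_ball_zero_iff.1 (hmem' r hr))
      have hwn : ‖w‖ ≤ L * ‖v‖ := by
        refine max_le ?_ (hFv r hr)
        change ‖r • v‖ ≤ _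
        rw [norm_smul, Real.norm_of_nonneg hr.1]
        nlinarith [norm_nonneg v, h.one_le, hr.2]
      -- The only use of integrability: exchanging `p` and `v` cancels the terms of first order in
      -- `v`. What remains is `DF(z)(w) v` and the Taylor remainder applied to `p + v`, giving the
      -- constants `L * L` and `L * L * L`.
      have hsym : fderiv ℝ F z w p = r • fderiv ℝ F z (p, F z p) v := by
        have : w = r • (v, F z v) := rfl
        rw [this, map_smul, smul_apply, hI r hr p v]
      have htay := h.norm_taylor_le (hmem r hr) hzw'
      have hdw : ‖fderiv ℝ F z w‖ ≤ L * (L * ‖v‖) :=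
        ((fderiv ℝ F z).le_of_opNorm_le (h.norm_fderiv_le z (hmem r hr)) w).trans (by gcongr)
      change dist _ (F (r • (p + v), q p r + r • F z v) (p + v)) ≤ _
      rw [dist_eq_norm, hzw]
      have hsplit : F z p + (r • fderiv ℝ F z (p, F z p) v + F z v) - F (z + w) (p + v) =
          -(fderiv ℝ F z w v) - (F (z + w) - F z - fderiv ℝ F z w) (p + v) := by
        rw [← hsym]
        simp only [sub_apply, map_add]
        abel
      rw [hsplit]
      calc _ ≤ ‖fderiv ℝ F z w v‖ + ‖(F (z + w) - F z - fderiv ℝ F z w) (p + v)‖ := by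
            simpa using norm_sub_le (-(fderiv ℝ F z w v))
              ((F (z + w) - F z - fderiv ℝ F z w) (p + v))
        _ ≤ L * (L * ‖v‖) * ‖v‖ + L * ‖w‖ * ‖w‖ * ‖p + v‖ := add_le_add
            ((fderiv ℝ F z w).le_of_opNorm_le hdw v)
            ((F (z + w) - F z - fderiv ℝ F z w).le_of_opNorm_le htay (p + v))
        _ ≤ L * (L * ‖v‖) * ‖v‖ + L * (L * ‖v‖) * (L * ‖v‖) * 1 := by gcongr
        _ = _ := by ring
  have hO : (fun x => q x 1 - q p 1 - F (p, q p 1) (x - p)) =O[𝓝 p] fun x => ‖x - p‖ ^ 2 :=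
    Asymptotics.IsBigO.of_bound _ (key.mono fun x hx => by simpa using hx)
  have h1 := hO.hasFDerivAt (𝕜 := ℝ) one_lt_two
  have h2 : HasFDerivAt (fun x => q p 1 + F (p, q p 1) (x - p)) (F (p, q p 1)) p := by
    simpa using ((F (p, q p 1)).hasFDerivAt.comp p ((hasFDerivAt_id p).sub_const p)).const_add
      (q p 1)
  have h3 := h1.add h2
  rw [zero_add] at h3
  refine h3.congr_of_eventuallyEq (Filter.Eventually.of_forall fun x => ?_)
  simp only [Pi.add_apply]
  abel

end BoundedOnBall

/-- Local solvability of the total differential system `Dφ(p) = F(p, φ(p))`, `φ(0) = 0`, when a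
condition `P` that implies integrability propagates along ray solutions. -/
theorem exists_hasFDerivAt_of_integrableAt [CompleteSpace G] {F : E × G → E →L[ℝ] G}
    (hF : ContDiffAt ℝ 2 F 0) {P : E × G → Prop} {S : Set (E × G)} (hS : S ∈ 𝓝 0)
    (hPI : ∀ z ∈ S, P z → IntegrableAt F z)
    (hP : ∀ p q, IsRaySolution F p q → (∀ r ∈ Icc (0 : ℝ) 1, (r • p, q r) ∈ S) →
      ∀ r ∈ Icc (0 : ℝ) 1, P (r • p, q r)) :
    ∃ φ : E → G, φ 0 = 0 ∧ ∀ᶠ p in 𝓝 0, HasFDerivAt φ (F (p, φ p)) p ∧ P (p, φ p) := by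
  obtain ⟨ρ, L, h⟩ := exists_boundedOnBall hF
  obtain ⟨ε, hε, hεS⟩ := Metric.mem_nhds_iff.1 hS
  have hL : 0 ≤ L := zero_le_one.trans h.one_le
  have hev : ∀ᶠ p : E in 𝓝 0, 2 * L * ‖p‖ < ρ ∧ 2 * L * ‖p‖ < ε ∧ ‖p‖ < 1 := by
    refine Filter.Eventually.and ?_ (Filter.Eventually.and ?_ ?_)
    · exact (Continuous.continuousAt (by fun_prop)).eventually_lt_const (by simpa using h.pos)
    · exact (Continuous.continuousAt (by fun_prop)).eventually_lt_const (by simpa using hε)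
    · exact continuous_norm.continuousAt.eventually_lt_const (by simp)
  have hex : ∀ p : E, ∃ q : ℝ → G, 2 * L * ‖p‖ < ρ → ‖p‖ < 1 →
      IsRaySolution F p q ∧ ∀ r ∈ Icc (0 : ℝ) 1, ‖q r‖ ≤ 2 * L * ‖p‖ := fun p => by
    by_cases hp : 2 * L * ‖p‖ < ρ ∧ ‖p‖ < 1
    · obtain ⟨q, hq⟩ := h.exists_isRaySolution hp.1 hp.2.le
      exact ⟨q, fun _ _ => hq⟩
    · exact ⟨0, fun h1 h2 => absurd ⟨h1, h2⟩ hp⟩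
  choose q hq using hex
  refine ⟨fun p => q p 1, ?_, ?_⟩
  · have := (hq 0 (by simpa using h.pos) (by simp)).2 1 (right_mem_Icc.2 zero_le_one)
    simpa using this
  · filter_upwards [hev.eventually_nhds] with p hp
    obtain ⟨hp1, hp2, hp3⟩ := hp.self_of_nhds
    obtain ⟨hsol, hbd⟩ := hq p hp1 hp3
    have hmem : ∀ r ∈ Icc (0 : ℝ) 1, (r • p, q p r) ∈ S := fun r hr => by
      refine hεS (mem_ball_zero_iff.2 (max_lt ?_ ((hbd r hr).trans_lt hp2)))
      change ‖r • p‖ < ε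
      rw [norm_smul, Real.norm_of_nonneg hr.1]
      nlinarith [norm_nonneg p, h.one_le, hr.2]
    have hPr := hP p (q p) hsol hmem
    refine ⟨h.hasFDerivAt_of_isRaySolution hp1 hp3 (hp.mono fun x hx => hq x hx.1 hx.2.2)
      fun r hr => hPI _ (hmem r hr) (hPr r hr), ?_⟩
    simpa using hPr 1 (right_mem_Icc.2 zero_le_one)

/-- Solutions of a total differential system with smooth right-hand side are smooth. -/
theorem contDiffOn_of_hasFDerivAt {F : E × G → E →L[ℝ] G} {φ : E → G} {s : Set E} (hs : IsOpen s)
    (hF : ∀ p ∈ s, ContDiffAt ℝ ∞ F (p, φ p)) (hφ : ∀ p ∈ s, HasFDerivAt φ (F (p, φ p)) p) :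
    ContDiffOn ℝ ∞ φ s := by
  rw [contDiffOn_infty]
  intro n
  induction n with
  | zero => exact contDiffOn_zero.2 fun p hp => (hφ p hp).continuousAt.continuousWithinAt
  | succ n ih =>
    push_cast
    refine (contDiffOn_succ_iff_fderiv_of_isOpen hs).2
      ⟨fun p hp => (hφ p hp).differentiableAt.differentiableWithinAt, by simp, ?_⟩
    have : ContDiffOn ℝ n (fun p => F (p, φ p)) s := fun p hp =>
      ((hF p hp).of_le (by exact_mod_cast le_top)).comp_contDiffWithinAt (f := fun p => (p, φ p)) p
        (contDiffWithinAt_id.prodMk (ih p hp))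
    exact this.congr fun p hp => (hφ p hp).fderiv

end TotalDifferential

/-! ### Frames, the transport system and its defect -/

section Frame

open Set

variable {U V : TopologicalSpace.Opens Plane} {A : Type*} [LieRing A] [LieAlgebra ℝ A]

theorem VectorFieldOn.sub_apply (X Y : VectorFieldOn U) (p : Plane) : (X - Y) p = X p - Y p := rfl

theorem VectorFieldOn.fderiv_sub (X Y : VectorFieldOn U) {p : Plane} (hp : p ∈ U) :
    fderiv ℝ (X - Y : VectorFieldOn U) p = fderiv ℝ X p - fderiv ℝ Y p :=
  _root_.fderiv_sub (X.differentiableAt hp) (Y.differentiableAt hp)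

/-- The linear map `c ↦ (ρ (σ c))(p)`, for a representation `ρ` by vector fields and a
two-parameter linear family `σ`. -/
def frame (ρ : A →ₗ⁅ℝ⁆ VectorFieldOn U) (σ : Plane →ₗ[ℝ] A) (p : Plane) : Plane →L[ℝ] Plane :=
  LinearMap.toContinuousLinearMap
    { toFun := fun c => ρ (σ c) p
      map_add' := fun c d => by rw [map_add, map_add]; rfl
      map_smul' := fun k c => by rw [map_smul, map_smul]; rfl }

variable {ρ : A →ₗ⁅ℝ⁆ VectorFieldOn U} {τ : A →ₗ⁅ℝ⁆ VectorFieldOn V} {σ : Plane →ₗ[ℝ] A}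

theorem frame_apply (p c : Plane) : frame ρ σ p c = ρ (σ c) p := rfl

theorem contDiffOn_frame : ContDiffOn ℝ ∞ (frame ρ σ) U :=
  contDiffOn_clm_apply.2 fun c => (ρ (σ c)).contDiffOn

theorem contDiffAt_frame {p : Plane} (hp : p ∈ U) : ContDiffAt ℝ ∞ (frame ρ σ) p :=
  contDiffOn_frame.contDiffAt (U.isOpen.mem_nhds hp)

theorem fderiv_frame_apply {p : Plane} (hp : p ∈ U) (x c : Plane) :
    fderiv ℝ (frame ρ σ) p x c = fderiv ℝ (ρ (σ c)) p x := by
  have h1 : HasFDerivAt (frame ρ σ) (fderiv ℝ (frame ρ σ) p) p :=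
    ((contDiffAt_frame hp).differentiableAt (by simp)).hasFDerivAt
  have h2 := h1.clm_apply (hasFDerivAt_const c p)
  have h3 : fderiv ℝ (ρ (σ c)) p = _ := h2.fderiv
  rw [h3]
  simp

theorem eventually_isInvertible_frame (h0 : (0 : Plane) ∈ U) (hinv : (frame ρ σ 0).IsInvertible) :
    ∀ᶠ p in 𝓝 0, p ∈ U ∧ (frame ρ σ p).IsInvertible := by
  obtain ⟨e, he⟩ := hinv
  have := (contDiffAt_frame (ρ := ρ) (σ := σ) h0).continuousAt.eventually
    (he ▸ ContinuousLinearEquiv.nhds e)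
  filter_upwards [this, U.isOpen.mem_nhds h0] with p hp hU using ⟨hU, hp⟩

theorem contDiffAt_inverse_frame {p : Plane} (hp : p ∈ U) (hinv : (frame ρ σ p).IsInvertible) :
    ContDiffAt ℝ ∞ (fun p => (frame ρ σ p).inverse) p :=
  ContDiffAt.comp p hinv.contDiffAt_map_inverse (contDiffAt_frame hp)

/-- The linear map taking the frame of `ρ` at `z.1` to the frame of `τ` at `z.2`. -/
def transport (ρ : A →ₗ⁅ℝ⁆ VectorFieldOn U) (τ : A →ₗ⁅ℝ⁆ VectorFieldOn V) (σ : Plane →ₗ[ℝ] A)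
    (z : Plane × Plane) : Plane →L[ℝ] Plane :=
  frame τ σ z.2 ∘L (frame ρ σ z.1).inverse

/-- The points `z` at which `transport` is well-defined and smooth. -/
def transportDomain (ρ : A →ₗ⁅ℝ⁆ VectorFieldOn U) (V : TopologicalSpace.Opens Plane)
    (σ : Plane →ₗ[ℝ] A) : Set (Plane × Plane) :=
  {z | (z.1 ∈ U ∧ (frame ρ σ z.1).IsInvertible) ∧ z.2 ∈ V}

theorem transportDomain_mem_nhds (h0 : (0 : Plane) ∈ U) (h0' : (0 : Plane) ∈ V)
    (hinv : (frame ρ σ 0).IsInvertible) : transportDomain ρ V σ ∈ 𝓝 (0 : Plane × Plane) := by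
  have h1 := (continuous_fst.tendsto (0 : Plane × Plane)).eventually
    (eventually_isInvertible_frame h0 hinv)
  have h2 := (continuous_snd.tendsto (0 : Plane × Plane)).eventually (V.isOpen.mem_nhds h0')
  exact h1.and h2

theorem isOpen_transportDomain : IsOpen (transportDomain ρ V σ) := by
  refine IsOpen.inter ?_ (V.isOpen.preimage continuous_snd)
  have h : IsOpen ((U : Set Plane) ∩ frame ρ σ ⁻¹' range ((↑) : (Plane ≃L[ℝ] Plane) → _)) :=
    contDiffOn_frame.continuousOn.isOpen_inter_preimage U.isOpen ContinuousLinearEquiv.isOpen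
  exact h.preimage continuous_fst

theorem contDiffAt_transport {z : Plane × Plane} (hz : z ∈ transportDomain ρ V σ) :
    ContDiffAt ℝ ∞ (transport ρ τ σ) z :=
  ((contDiffAt_frame hz.2).comp z contDiffAt_snd).clm_comp
    ((contDiffAt_inverse_frame hz.1.1 hz.1.2).comp z contDiffAt_fst)

theorem transport_apply {z : Plane × Plane} (hz : z ∈ transportDomain ρ V σ) (c : Plane) :
    transport ρ τ σ z (ρ (σ c) z.1) = τ (σ c) z.2 := by
  rw [← frame_apply (ρ := ρ), ← frame_apply (ρ := τ)]
  exact congrArg (frame τ σ z.2) (hz.1.2.inverse_apply_self c)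

theorem apply_inverse_frame {p : Plane} (h : (frame ρ σ p).IsInvertible) (u : Plane) :
    ρ (σ ((frame ρ σ p).inverse u)) p = u :=
  h.self_apply_inverse u

/-- Differentiate the identity `transport_apply` with the product rule; this avoids differentiating
the inverse frame. -/
theorem fderiv_transport_apply {z : Plane × Plane} (hz : z ∈ transportDomain ρ V σ)
    (x y d : Plane) :
    fderiv ℝ (transport ρ τ σ) z (x, y) (ρ (σ d) z.1) =
      fderiv ℝ (τ (σ d)) z.2 y - transport ρ τ σ z (fderiv ℝ (ρ (σ d)) z.1 x) := by
  have hF : HasFDerivAt (transport ρ τ σ) (fderiv ℝ (transport ρ τ σ) z) z :=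
    ((contDiffAt_transport hz).differentiableAt (by simp)).hasFDerivAt
  have h1 : HasFDerivAt (fun z : Plane × Plane => ρ (σ d) z.1) _ z :=
    ((ρ (σ d)).differentiableAt hz.1.1).hasFDerivAt.comp z hasFDerivAt_fst
  have h2 : HasFDerivAt (fun z : Plane × Plane => τ (σ d) z.2) _ z :=
    ((τ (σ d)).differentiableAt hz.2).hasFDerivAt.comp z hasFDerivAt_snd
  have h3 := hF.clm_apply h1
  have h4 : (fun z => transport ρ τ σ z (ρ (σ d) z.1)) =ᶠ[𝓝 z] fun z => τ (σ d) z.2 := by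
    filter_upwards [isOpen_transportDomain.mem_nhds hz] with w hw using transport_apply hw d
  have h5 := congrArg (fun T => T (x, y)) ((h2.congr_of_eventuallyEq h4).unique h3)
  simp only [ContinuousLinearMap.comp_apply, ContinuousLinearMap.flip_apply,
    add_apply, ContinuousLinearMap.coe_fst', ContinuousLinearMap.coe_snd'] at h5
  rw [h5, add_sub_cancel_left]

/-- The deviation of `transport` from taking `ρ w` to `τ w`. -/
def defect (ρ : A →ₗ⁅ℝ⁆ VectorFieldOn U) (τ : A →ₗ⁅ℝ⁆ VectorFieldOn V) (σ : Plane →ₗ[ℝ] A)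
    (w : A) (z : Plane × Plane) : Plane :=
  τ w z.2 - transport ρ τ σ z (ρ w z.1)

theorem defect_add (w w' : A) (z : Plane × Plane) :
    defect ρ τ σ (w + w') z = defect ρ τ σ w z + defect ρ τ σ w' z := by
  simp only [defect, map_add, VectorFieldOn.add_apply]
  abel

theorem defect_smul (k : ℝ) (w : A) (z : Plane × Plane) :
    defect ρ τ σ (k • w) z = k • defect ρ τ σ w z := by
  simp only [defect, map_smul, VectorFieldOn.smul_apply, smul_sub]

theorem defect_apply_eq_zero {z : Plane × Plane} (hz : z ∈ transportDomain ρ V σ) (c : Plane) :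
    defect ρ τ σ (σ c) z = 0 := by
  rw [defect, transport_apply hz, sub_self]

/-- For `u`, `v` expressed in the frame as `σ c`, `σ d`, the asymmetry of the derivative is exactly
the defect of `⁅σ c, σ d⁆`. -/
theorem integrableAt_transport {z : Plane × Plane} (hz : z ∈ transportDomain ρ V σ)
    (h : ∀ w, defect ρ τ σ w z = 0) : IntegrableAt (transport ρ τ σ) z := by
  intro u v
  obtain ⟨c, rfl⟩ : ∃ c, ρ (σ c) z.1 = u := ⟨_, apply_inverse_frame hz.1.2 u⟩
  obtain ⟨d, rfl⟩ : ∃ d, ρ (σ d) z.1 = v := ⟨_, apply_inverse_frame hz.1.2 v⟩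
  rw [fderiv_transport_apply hz, fderiv_transport_apply hz, transport_apply hz, transport_apply hz]
  have hb := h ⁅σ c, σ d⁆
  rw [defect, LieHom.map_lie, LieHom.map_lie, VectorFieldOn.bracket_apply _ _ hz.1.1,
    VectorFieldOn.bracket_apply _ _ hz.2, map_sub] at hb
  rw [← sub_eq_zero, ← hb]
  abel

/-- The derivative of the defect along a ray solution. -/
theorem hasDerivAt_defect {p : Plane} {q : ℝ → Plane} {r : ℝ}
    (hq : HasDerivAt q (transport ρ τ σ (r • p, q r) p) r)
    (hz : (r • p, q r) ∈ transportDomain ρ V σ) (w : A) {c h : Plane}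
    (hc : ρ (σ c) (r • p) = p) (hh : ρ (σ h) (r • p) = ρ w (r • p)) :
    HasDerivAt (fun s => defect ρ τ σ w (s • p, q s))
      (defect ρ τ σ ⁅σ c, w - σ h⁆ (r • p, q r) +
        fderiv ℝ (τ (σ c)) (q r) (defect ρ τ σ w (r • p, q r))) r := by
  have hF : HasFDerivAt (transport ρ τ σ) (fderiv ℝ (transport ρ τ σ) (r • p, q r)) (r • p, q r) :=
    ((contDiffAt_transport hz).differentiableAt (by simp)).hasFDerivAt
  have hray : HasDerivAt (fun s : ℝ => s • p) p r := by
    simpa using (hasDerivAt_id r).smul_const p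
  have h1 : HasDerivAt (fun s => transport ρ τ σ (s • p, q s))
      (fderiv ℝ (transport ρ τ σ) (r • p, q r) (p, transport ρ τ σ (r • p, q r) p)) r :=
    hF.comp_hasDerivAt (f := fun s : ℝ => (s • p, q s)) r (hray.prodMk hq)
  have h2 : HasDerivAt (fun s : ℝ => ρ w (s • p)) _ r :=
    ((ρ w).differentiableAt hz.1.1).hasFDerivAt.comp_hasDerivAt r hray
  have h3 : HasDerivAt (fun s : ℝ => τ w (q s)) _ r :=
    ((τ w).differentiableAt hz.2).hasFDerivAt.comp_hasDerivAt r hq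
  refine (h3.sub (h1.clm_apply h2)).congr_deriv ?_
  set z : Plane × Plane := (r • p, q r) with hz'
  have e1 : transport ρ τ σ z p = τ (σ c) z.2 := by
    rw [← transport_apply hz c]
    exact congrArg _ hc.symm
  have e2 : fderiv ℝ (transport ρ τ σ) z (p, τ (σ c) z.2) (ρ w (r • p)) = _ :=
    hh ▸ fderiv_transport_apply hz p (τ (σ c) z.2) h
  -- Subtracting `σ h` leaves the defect unchanged and makes the `ρ`-field vanish at `z.1`, so one
  -- term of its bracket with `σ c` drops out.
  have e3 : defect ρ τ σ w z = τ (w - σ h) z.2 := by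
    rw [map_sub, VectorFieldOn.sub_apply, defect, ← transport_apply hz h]
    congr 2
    exact hh.symm
  have e4 : ρ (w - σ h) z.1 = 0 := by
    rw [map_sub, VectorFieldOn.sub_apply]
    exact sub_eq_zero.2 hh.symm
  have e5 : ρ (σ c) z.1 = p := hc
  rw [e1, e2, e3, defect, LieHom.map_lie, LieHom.map_lie, VectorFieldOn.bracket_apply _ _ hz.1.1,
    VectorFieldOn.bracket_apply _ _ hz.2, e4, e5, map_sub ρ, map_sub τ,
    VectorFieldOn.fderiv_sub _ _ hz.1.1, VectorFieldOn.fderiv_sub _ _ hz.2]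
  simp only [map_zero, sub_zero, sub_apply, map_sub]
  change _ - (_ + transport ρ τ σ z (fderiv ℝ (ρ w) z.1 p)) = _
  abel

/-- `A` is spanned by `e` and the range of `σ`, with `κ` the coordinate along `e`. -/
def IsSplitting (σ : Plane →ₗ[ℝ] A) (e : A) (κ : A →ₗ[ℝ] ℝ) : Prop :=
  ∀ w, ∃ c, w = κ w • e + σ c

variable {e : A} {κ : A →ₗ[ℝ] ℝ}

theorem IsSplitting.defect_eq (h : IsSplitting σ e κ) {z : Plane × Plane}
    (hz : z ∈ transportDomain ρ V σ) (w : A) :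
    defect ρ τ σ w z = κ w • defect ρ τ σ e z := by
  obtain ⟨c, hc⟩ := h w
  nth_rw 1 [hc]
  rw [defect_add, defect_smul, defect_apply_eq_zero hz, add_zero]

theorem continuous_bracket_coeff (σ : Plane →ₗ[ℝ] A) (e : A) (κ : A →ₗ[ℝ] ℝ) :
    Continuous fun x : Plane × Plane => κ ⁅σ x.1, e - σ x.2⁆ := by
  let β : Plane →ₗ[ℝ] Plane →ₗ[ℝ] ℝ := LinearMap.mk₂ ℝ (fun c h => κ ⁅σ c, σ h⁆)
    (fun _ _ _ => by simp) (fun _ _ _ => by simp) (fun _ _ _ => by simp) (fun _ _ _ => by simp)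
  let α : Plane →ₗ[ℝ] ℝ :=
    { toFun := fun c => κ ⁅σ c, e⁆
      map_add' := fun _ _ => by simp
      map_smul' := fun _ _ => by simp }
  have h1 : Continuous fun x : Plane × Plane =>
      α.toContinuousLinearMap x.1 - β.toContinuousBilinearMap x.1 x.2 := by fun_prop
  refine h1.congr fun x => ?_
  change κ ⁅σ x.1, e⁆ - κ ⁅σ x.1, σ x.2⁆ = _
  rw [lie_sub, map_sub]

/-- A curve satisfying a linear differential equation on `[0, 1]` vanishes if it starts at `0`. -/
theorem eq_zero_of_hasDerivAt_clm {E : Type*} [NormedAddCommGroup E] [NormedSpace ℝ E]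
    {D : ℝ → E} {T : ℝ → E →L[ℝ] E} (hT : ContinuousOn T (Icc 0 1))
    (hD : ∀ r ∈ Icc (0 : ℝ) 1, HasDerivAt D (T r (D r)) r) (h0 : D 0 = 0) :
    ∀ r ∈ Icc (0 : ℝ) 1, D r = 0 := by
  obtain ⟨K, hK⟩ := isCompact_Icc.exists_bound_of_continuousOn hT
  exact eq_zero_of_abs_deriv_le_mul_abs_self_of_eq_zero_right (K := K)
    (fun r hr => (hD r hr).continuousAt.continuousWithinAt)
    (fun r hr => (hD r ⟨hr.1, hr.2.le⟩).hasDerivWithinAt) h0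
    fun r hr => (T r).le_of_opNorm_le (hK r ⟨hr.1, hr.2.le⟩) _

theorem continuousAt_frameCoord {p : Plane} {r : ℝ} (hU : r • p ∈ U)
    (hinv : (frame ρ σ (r • p)).IsInvertible) {f : ℝ → Plane} (hf : ContinuousAt f r) :
    ContinuousAt (fun s : ℝ => (frame ρ σ (s • p)).inverse (f s)) r := by
  have h1 : ContinuousAt (fun s : ℝ => s • p) r := by fun_prop
  exact (ContinuousAt.comp (f := fun s : ℝ => s • p)
    (contDiffAt_inverse_frame hU hinv).continuousAt h1).clm_apply hf

/-- The bracket term in `hasDerivAt_defect` is itself a multiple of the defect of `e`, so the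
equation for that defect closes up and is linear homogeneous with continuous coefficients. -/
theorem IsSplitting.defect_eq_zero (h : IsSplitting σ e κ) (he : τ e 0 = 0) (he' : ρ e 0 = 0)
    {p : Plane} {q : ℝ → Plane} (hq : IsRaySolution (transport ρ τ σ) p q)
    (hz : ∀ r ∈ Icc (0 : ℝ) 1, (r • p, q r) ∈ transportDomain ρ V σ) :
    ∀ r ∈ Icc (0 : ℝ) 1, ∀ w, defect ρ τ σ w (r • p, q r) = 0 := by
  set c : ℝ → Plane := fun s => (frame ρ σ (s • p)).inverse p with hc
  set d : ℝ → Plane := fun s => (frame ρ σ (s • p)).inverse (ρ e (s • p)) with hd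
  set T : ℝ → Plane →L[ℝ] Plane := fun r => κ ⁅σ (c r), e - σ (d r)⁆ • ContinuousLinearMap.id ℝ _ +
    (fderiv ℝ (frame τ σ) (q r)).flip (c r) with hTdef
  have hT : ContinuousOn T (Icc 0 1) := fun r hr => by
    have h1 : ContinuousAt c r :=
      continuousAt_frameCoord (hz r hr).1.1 (hz r hr).1.2 continuousAt_const
    have hray : ContinuousAt (fun s : ℝ => s • p) r := by fun_prop
    have h2 : ContinuousAt d r :=
      continuousAt_frameCoord (hz r hr).1.1 (hz r hr).1.2 (ContinuousAt.comp
        (f := fun s : ℝ => s • p) ((ρ e).contDiffAt (hz r hr).1.1).continuousAt hray)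
    have h3 : ContinuousAt (fun s => κ ⁅σ (c s), e - σ (d s)⁆) r :=
      ContinuousAt.comp (f := fun s => (c s, d s)) (continuous_bracket_coeff σ e κ).continuousAt
        (h1.prodMk h2)
    have h4 : ContinuousAt (fun s => fderiv ℝ (frame τ σ) (q s)) r :=
      ContinuousAt.comp (f := q) ((contDiffAt_frame (hz r hr).2).fderiv_right (m := ∞)
        (by simp)).continuousAt (hq.2 r hr).continuousAt
    have h5 : ContinuousAt (fun s => (fderiv ℝ (frame τ σ) (q s)).flip) r :=
      ContinuousAt.comp (f := fun s => fderiv ℝ (frame τ σ) (q s))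
        (ContinuousLinearMap.flipₗᵢ ℝ Plane Plane Plane).continuous.continuousAt h4
    exact ((h3.smul continuousAt_const).add (h5.clm_apply h1)).continuousWithinAt
  have hzero := eq_zero_of_hasDerivAt_clm (D := fun s => defect ρ τ σ e (s • p, q s)) hT
    (fun r hr => ?_) (by simp [defect, hq.1, he, he'])
  · intro r hr w
    rw [h.defect_eq (hz r hr) w, hzero r hr, smul_zero]
  · refine (hasDerivAt_defect (hq.2 r hr) (hz r hr) e (c := c r) (h := d r)
      (apply_inverse_frame (hz r hr).1.2 p) (apply_inverse_frame (hz r hr).1.2 _)).congr_deriv ?_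
    rw [h.defect_eq (hz r hr) ⁅_, _⁆]
    simp only [hTdef, add_apply, smul_apply, ContinuousLinearMap.id_apply,
      ContinuousLinearMap.flip_apply]
    rw [fderiv_frame_apply (hz r hr).2]

/-- If `e` spans an ideal and `ρ e` vanishes at the origin, then `ρ e` vanishes nearby. -/
theorem eventually_eq_zero_of_bracket (h0 : (0 : Plane) ∈ U) (hinv : (frame ρ σ 0).IsInvertible)
    (he : ρ e 0 = 0) (hb : ∀ c, ⁅σ c, e⁆ = κ ⁅σ c, e⁆ • e) : ∀ᶠ p in 𝓝 0, ρ e p = 0 := by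
  obtain ⟨ε, hε, hball⟩ := Metric.eventually_nhds_iff_ball.1 (eventually_isInvertible_frame h0 hinv)
  filter_upwards [Metric.ball_mem_nhds (0 : Plane) hε] with p hp
  have hz : ∀ r ∈ Icc (0 : ℝ) 1, r • p ∈ U ∧ (frame ρ σ (r • p)).IsInvertible := fun r hr => by
    refine hball _ ?_
    rw [mem_ball_zero_iff] at hp ⊢
    rw [norm_smul, Real.norm_of_nonneg hr.1]
    nlinarith [norm_nonneg p, hr.2]
  set c : ℝ → Plane := fun s => (frame ρ σ (s • p)).inverse p with hc
  have hray : ∀ r : ℝ, HasDerivAt (fun s : ℝ => s • p) p r := fun r => by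
    simpa using (hasDerivAt_id r).smul_const p
  -- From `Dρ(e)(p) = [ρ(σ c), ρ e] + Dρ(σ c)(ρ e)` with `ρ(σ c) = p` at `r • p`; the bracket is a
  -- multiple of `ρ e`. The zero term `σ 0` only fits the coefficient to `continuous_bracket_coeff`.
  set T : ℝ → Plane →L[ℝ] Plane := fun r => κ ⁅σ (c r), e - σ 0⁆ • ContinuousLinearMap.id ℝ _ +
    (fderiv ℝ (frame ρ σ) (r • p)).flip (c r) with hTdef
  have hT : ContinuousOn T (Icc 0 1) := fun r hr => by
    have h1 : ContinuousAt c r := continuousAt_frameCoord (hz r hr).1 (hz r hr).2 continuousAt_const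
    have h3 : ContinuousAt (fun s => κ ⁅σ (c s), e - σ 0⁆) r :=
      ContinuousAt.comp (f := fun s => (c s, (0 : Plane)))
        (continuous_bracket_coeff σ e κ).continuousAt (h1.prodMk continuousAt_const)
    have h4 : ContinuousAt (fun s : ℝ => fderiv ℝ (frame ρ σ) (s • p)) r :=
      ContinuousAt.comp (f := fun s : ℝ => s • p) ((contDiffAt_frame (hz r hr).1).fderiv_right
        (m := ∞) (by simp)).continuousAt (hray r).continuousAt
    have h5 : ContinuousAt (fun s : ℝ => (fderiv ℝ (frame ρ σ) (s • p)).flip) r :=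
      ContinuousAt.comp (f := fun s : ℝ => fderiv ℝ (frame ρ σ) (s • p))
        (ContinuousLinearMap.flipₗᵢ ℝ Plane Plane Plane).continuous.continuousAt h4
    exact ((h3.smul continuousAt_const).add (h5.clm_apply h1)).continuousWithinAt
  have hzero := eq_zero_of_hasDerivAt_clm (D := fun s : ℝ => ρ e (s • p)) hT
    (fun r hr => ?_) (by simpa using he) 1 (right_mem_Icc.2 zero_le_one)
  · simpa using hzero
  · have hd : HasDerivAt (fun s : ℝ => ρ e (s • p)) (fderiv ℝ (ρ e) (r • p) p) r :=
      ((ρ e).differentiableAt (hz r hr).1).hasFDerivAt.comp_hasDerivAt r (hray r)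
    refine hd.congr_deriv ?_
    have hcr : ρ (σ (c r)) (r • p) = p := apply_inverse_frame (hz r hr).2 p
    have hbr := VectorFieldOn.bracket_apply (ρ (σ (c r))) (ρ e) (hz r hr).1
    rw [← LieHom.map_lie, hb, map_smul, VectorFieldOn.smul_apply, hcr] at hbr
    simp only [hTdef, add_apply, smul_apply, ContinuousLinearMap.id_apply,
      ContinuousLinearMap.flip_apply, map_zero, sub_zero]
    rw [fderiv_frame_apply (hz r hr).1, hbr, sub_add_cancel]

end Frame

open Set

variable {U V : TopologicalSpace.Opens Plane}

/-! ### Splitting off the isotropy; it is not an ideal -/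

section Splitting

variable {h0 : (0 : Plane) ∈ U} {g : LieSubalgebra ℝ (VectorFieldOn U)}

theorem mem_isotropy {X : g} : X ∈ isotropy h0 g ↔ X.1 0 = 0 := Iff.rfl

theorem IsTransitive3.finiteDimensional (hg : IsTransitive3 h0 g) : FiniteDimensional ℝ g :=
  Module.finite_of_finrank_pos (by rw [hg.finrank_eq]; norm_num)

/-- Evaluation at the origin. -/
def evalOrigin (g : LieSubalgebra ℝ (VectorFieldOn U)) : g →ₗ[ℝ] Plane where
  toFun X := X.1 0
  map_add' _ _ := rfl
  map_smul' _ _ := rfl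

theorem IsTransitive3.exists_splitting (hg : IsTransitive3 h0 g) :
    ∃ (σ : Plane →ₗ[ℝ] g) (e : g) (κ : g →ₗ[ℝ] ℝ), (∀ c, (σ c).1 0 = c) ∧ e ≠ 0 ∧
      e.1 0 = 0 ∧ IsSplitting σ e κ ∧ ∀ w : g, w.1 0 = 0 → w = κ w • e := by
  have := hg.finiteDimensional
  have hker : Module.finrank ℝ (LinearMap.ker (evalOrigin g)) = 1 := hg.finrank_isotropy
  have hrange : LinearMap.range (evalOrigin g) = ⊤ := by
    apply Submodule.eq_top_of_finrank_eq
    have h1 := (evalOrigin g).finrank_range_add_finrank_ker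
    rw [hg.finrank_eq, hker] at h1
    have h2 : Module.finrank ℝ Plane = 2 := by simp [Plane]
    omega
  obtain ⟨σ, hσ⟩ := (evalOrigin g).exists_rightInverse_of_surjective hrange
  have hσ' : ∀ c, (σ c).1 0 = c := fun c => LinearMap.congr_fun hσ c
  obtain ⟨e, he, hspan⟩ := finrank_eq_one_iff'.1 hker
  have he' : e.1 ≠ 0 := fun h => he (Subtype.ext h)
  obtain ⟨f, hf⟩ : ∃ f : Module.Dual ℝ g, f e.1 ≠ 0 := by
    by_contra! h
    exact he' ((Module.forall_dual_apply_eq_zero_iff ℝ e.1).1 h)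
  -- The projection along the range of `σ` lands in the line of `e`; a functional nonzero on `e`,
  -- normalized, reads off the coordinate.
  let κ : g →ₗ[ℝ] ℝ := (f e.1)⁻¹ • (f ∘ₗ (LinearMap.id - σ ∘ₗ evalOrigin g))
  have hκ : ∀ w : g, w = κ w • e.1 + σ (w.1 0) := fun w => by
    have hw : w - σ (w.1 0) ∈ LinearMap.ker (evalOrigin g) := by
      rw [LinearMap.mem_ker, map_sub]
      exact sub_eq_zero.2 (hσ' _).symm
    obtain ⟨k, hk⟩ := hspan ⟨_, hw⟩
    have hk' : k • e.1 = w - σ (w.1 0) := congrArg Subtype.val hk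
    have : κ w = k := by
      change (f e.1)⁻¹ • f (w - σ (w.1 0)) = k
      rw [← hk', map_smul, smul_eq_mul, smul_eq_mul]
      field_simp
    rw [this, hk', sub_add_cancel]
  refine ⟨σ, e.1, κ, hσ', he', e.2, fun w => ⟨_, hκ w⟩, fun w hw => ?_⟩
  have := hκ w
  rwa [hw, map_zero, add_zero] at this

theorem frame_incl_zero {σ : Plane →ₗ[ℝ] g} (hσ : ∀ c, (σ c).1 0 = c) :
    (frame g.incl σ 0).IsInvertible :=
  ⟨ContinuousLinearEquiv.refl ℝ Plane, ContinuousLinearMap.ext fun c => (hσ c).symm⟩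

theorem IsTransitive3.exists_bracket_notMem_isotropy (hg : IsTransitive3 h0 g) :
    ∃ X : g, ∃ X₀ ∈ isotropy h0 g, ⁅X, X₀⁆ ∉ isotropy h0 g := by
  by_contra! h
  obtain ⟨σ, e, κ, hσ, hne, he, -, hκ⟩ := hg.exists_splitting
  have := eventually_eq_zero_of_bracket (ρ := g.incl) (σ := σ) (e := e) (κ := κ) h0
    (frame_incl_zero hσ) he fun c => hκ _ (h (σ c) e he)
  exact hne (Subtype.ext (hg.eq_zero_of_eventually e.1 e.2 this))

end Splitting

/-! ### Push-forwards and the two implications -/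

section Pushforward

variable {φ : OpenPartialHomeomorph Plane Plane}

namespace IsLocalDiffeoFixingOrigin

theorem contDiffAt (hφ : IsLocalDiffeoFixingOrigin U V φ) {p : Plane} (hp : p ∈ φ.source) :
    ContDiffAt ℝ ∞ φ p :=
  hφ.contDiffOn.contDiffAt (φ.open_source.mem_nhds hp)

theorem fderiv_injective (hφ : IsLocalDiffeoFixingOrigin U V φ) {p : Plane} (hp : p ∈ φ.source) :
    Function.Injective (fderiv ℝ φ p) := by
  have h1 : HasFDerivAt φ (fderiv ℝ φ p) p :=
    ((hφ.contDiffAt hp).differentiableAt (by simp)).hasFDerivAt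
  have h2 : HasFDerivAt φ.symm (fderiv ℝ φ.symm (φ p)) (φ p) :=
    ((hφ.contDiffOn_symm.contDiffAt (φ.open_target.mem_nhds (φ.map_source hp))).differentiableAt
      (by simp)).hasFDerivAt
  have h3 : φ.symm ∘ φ =ᶠ[𝓝 p] id := φ.eventually_left_inverse hp
  have h4 := ((h2.comp p h1).congr_of_eventuallyEq h3.symm).unique (hasFDerivAt_id p)
  exact Function.LeftInverse.injective (g := fderiv ℝ φ.symm (φ p)) fun v =>
    congrArg (fun T => T v) h4

theorem zero_mem_target (hφ : IsLocalDiffeoFixingOrigin U V φ) : (0 : Plane) ∈ φ.target := by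
  have := φ.map_source hφ.zero_mem_source
  rwa [hφ.map_zero] at this

end IsLocalDiffeoFixingOrigin

theorem PushesTo.add {X X' : VectorFieldOn U} {Y Y' : VectorFieldOn V} (h : PushesTo φ X Y)
    (h' : PushesTo φ X' Y') : PushesTo φ (X + X') (Y + Y') := fun p hp => by
  rw [VectorFieldOn.add_apply, VectorFieldOn.add_apply, map_add, h p hp, h' p hp]

theorem PushesTo.smul {X : VectorFieldOn U} {Y : VectorFieldOn V} (h : PushesTo φ X Y) (k : ℝ) :
    PushesTo φ (k • X) (k • Y) := fun p hp => by
  rw [VectorFieldOn.smul_apply, VectorFieldOn.smul_apply, map_smul, h p hp]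

theorem PushesTo.fderiv_eq {X : VectorFieldOn U} {Y : VectorFieldOn V} (h : PushesTo φ X Y)
    (hφ : IsLocalDiffeoFixingOrigin U V φ) {p : Plane} (hp : p ∈ φ.source) (v : Plane) :
    fderiv ℝ (fun x => fderiv ℝ φ x (X x)) p v = fderiv ℝ Y (φ p) (fderiv ℝ φ p v) := by
  have h1 : (fun x => fderiv ℝ φ x (X x)) =ᶠ[𝓝 p] Y ∘ φ := by
    filter_upwards [φ.open_source.mem_nhds hp] with x hx using h x hx
  rw [h1.fderiv_eq, fderiv_comp p (Y.differentiableAt (hφ.target_subset (φ.map_source hp)))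
    ((hφ.contDiffAt hp).differentiableAt (by simp))]
  rfl

/-- Differentiating `Dφ X = Y ∘ φ` and antisymmetrizing, the second derivatives of `φ` cancel by
symmetry. -/
theorem PushesTo.lie {X X' : VectorFieldOn U} {Y Y' : VectorFieldOn V} (h : PushesTo φ X Y)
    (h' : PushesTo φ X' Y') (hφ : IsLocalDiffeoFixingOrigin U V φ) :
    PushesTo φ ⁅X, X'⁆ ⁅Y, Y'⁆ := fun p hp => by
  have hs : minSmoothness ℝ 2 ≤ (∞ : WithTop ℕ∞) := by
    rw [minSmoothness_of_isRCLikeNormedField]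
    exact WithTop.coe_le_coe.2 le_top
  have hU := hφ.source_subset hp
  have h1 := VectorField.fderiv_apply_lieBracket (hφ.contDiffAt hp) hs
    (X'.differentiableAt hU) (X.differentiableAt hU)
  rw [(VectorFieldOn.bracket_eventuallyEq X X' hU).eq_of_nhds, h1, h.fderiv_eq hφ hp,
    h'.fderiv_eq hφ hp, h p hp, h' p hp,
    VectorFieldOn.bracket_apply _ _ (hφ.target_subset (φ.map_source hp))]

theorem PushesTo.unique {hV : (0 : Plane) ∈ V} {g' : LieSubalgebra ℝ (VectorFieldOn V)}
    (hg' : IsTransitive3 hV g') (hφ : IsLocalDiffeoFixingOrigin U V φ) {X : VectorFieldOn U}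
    {Y Y' : VectorFieldOn V} (hY : Y ∈ g') (hY' : Y' ∈ g') (h : PushesTo φ X Y)
    (h' : PushesTo φ X Y') : Y = Y' := by
  refine sub_eq_zero.1 (hg'.eq_zero_of_eventually _ (sub_mem hY hY') ?_)
  filter_upwards [φ.open_target.mem_nhds hφ.zero_mem_target] with y hy
  have hs := φ.map_target hy
  have e := (h _ hs).symm.trans (h' _ hs)
  rw [φ.right_inv hy] at e
  rw [VectorFieldOn.sub_apply, e, sub_self]

theorem exists_lieEquiv_of_pushesTo {hU : (0 : Plane) ∈ U} {hV : (0 : Plane) ∈ V}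
    {g : LieSubalgebra ℝ (VectorFieldOn U)} {g' : LieSubalgebra ℝ (VectorFieldOn V)}
    (hg : IsTransitive3 hU g) (hg' : IsTransitive3 hV g') (hφ : IsLocalDiffeoFixingOrigin U V φ)
    (h : ∀ X ∈ g, ∃ Y ∈ g', PushesTo φ X Y) :
    ∃ ψ : g ≃ₗ⁅ℝ⁆ g', (isotropy hU g).map (ψ : g →ₗ⁅ℝ⁆ g') = isotropy hV g' := by
  have := hg.finiteDimensional
  have := hg'.finiteDimensional
  have h' : ∀ X : g, ∃ Y : g', PushesTo φ X.1 Y.1 := fun X => by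
    obtain ⟨Y, hY, hXY⟩ := h X.1 X.2
    exact ⟨⟨Y, hY⟩, hXY⟩
  choose f hf using h'
  have huniq : ∀ {X : g} {Y : g'}, PushesTo φ X.1 Y.1 → f X = Y := fun hXY =>
    Subtype.ext (PushesTo.unique hg' hφ (f _).2 (Subtype.mem _) (hf _) hXY)
  let F : g →ₗ⁅ℝ⁆ g' :=
    { toFun := f
      map_add' := fun X X' => huniq ((hf X).add (hf X'))
      map_smul' := fun k X => huniq ((hf X).smul k)
      map_lie' := fun {X X'} => huniq ((hf X).lie (hf X') hφ) }
  have hinj : Function.Injective F := by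
    refine (injective_iff_map_eq_zero F).2 fun X hX => Subtype.ext ?_
    refine hg.eq_zero_of_eventually X.1 X.2 ?_
    filter_upwards [φ.open_source.mem_nhds hφ.zero_mem_source] with p hp
    refine hφ.fderiv_injective hp ?_
    rw [hf X p hp, map_zero]
    exact congrArg (fun Y : g' => Y.1 (φ p)) hX
  have hsurj : Function.Surjective F :=
    (LinearMap.injective_iff_surjective_of_finrank_eq_finrank (f := (F : g →ₗ[ℝ] g'))
      (by rw [hg.finrank_eq, hg'.finrank_eq])).1 hinj
  have hiso : ∀ X : g, (f X).1 0 = 0 ↔ X.1 0 = 0 := fun X => by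
    have e := hf X 0 hφ.zero_mem_source
    rw [hφ.map_zero] at e
    rw [← e]
    exact map_eq_zero_iff _ (hφ.fderiv_injective hφ.zero_mem_source)
  refine ⟨LieEquiv.ofBijective F ⟨hinj, hsurj⟩, ?_⟩
  ext Y
  rw [LieSubalgebra.mem_map]
  constructor
  · rintro ⟨X, hX, rfl⟩
    exact (hiso X).2 hX
  · intro hY
    obtain ⟨X, rfl⟩ := hsurj Y
    exact ⟨X, (hiso X).1 hY, rfl⟩

/-- A function that is smooth near the origin and has invertible derivative there restricts to a
local coordinate transformation. -/
theorem exists_isLocalDiffeoFixingOrigin {f : Plane → Plane} {s : Set Plane} (hs : IsOpen s)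
    (h0 : (0 : Plane) ∈ s) (hf0 : f 0 = 0) (hsU : s ⊆ U) (hsV : MapsTo f s V)
    (hf : ContDiffOn ℝ ∞ f s) (hinv : ∀ p ∈ s, (fderiv ℝ f p).IsInvertible) :
    ∃ φ : OpenPartialHomeomorph Plane Plane,
      IsLocalDiffeoFixingOrigin U V φ ∧ φ.source ⊆ s ∧ ⇑φ = f := by
  have hat : ∀ p ∈ s, ContDiffAt ℝ ∞ f p := fun p hp => hf.contDiffAt (hs.mem_nhds hp)
  have hder : ∀ p ∈ s, HasFDerivAt f (fderiv ℝ f p) p := fun p hp =>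
    ((hat p hp).differentiableAt (by simp)).hasFDerivAt
  obtain ⟨A, hA⟩ := hinv 0 h0
  have hA' : HasFDerivAt f (A : Plane →L[ℝ] Plane) 0 := hA ▸ hder 0 h0
  -- Restriction to `s` guarantees an invertible derivative at every source point, which makes the
  -- inverse smooth on the whole target.
  let φ := ((hat 0 h0).toOpenPartialHomeomorph f hA' (by simp)).restrOpen s hs
  have hsrc : φ.source ⊆ s := fun p hp => hp.2
  refine ⟨φ, ⟨⟨(hat 0 h0).mem_toOpenPartialHomeomorph_source hA' (by simp), h0⟩, hf0,
    hsrc.trans hsU, fun y hy => ?_, hf.mono hsrc, fun y hy => ?_⟩, hsrc, rfl⟩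
  · rw [← φ.right_inv hy]
    exact hsV (hsrc (φ.map_target hy))
  · have hm := hsrc (φ.map_target hy)
    obtain ⟨B, hB⟩ := hinv _ hm
    exact (φ.contDiffAt_symm hy (f₀' := B) (hB ▸ hder _ hm) (hat _ hm)).contDiffWithinAt

theorem exists_pushesTo_of_lieEquiv {hU : (0 : Plane) ∈ U} {hV : (0 : Plane) ∈ V}
    {g : LieSubalgebra ℝ (VectorFieldOn U)} {g' : LieSubalgebra ℝ (VectorFieldOn V)}
    (hg : IsTransitive3 hU g) (ψ : g ≃ₗ⁅ℝ⁆ g')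
    (hψ : (isotropy hU g).map (ψ : g →ₗ⁅ℝ⁆ g') = isotropy hV g') :
    ∃ φ : OpenPartialHomeomorph Plane Plane,
      IsLocalDiffeoFixingOrigin U V φ ∧ ∀ X ∈ g, ∃ Y ∈ g', PushesTo φ X Y := by
  have hiso : ∀ X : g, (ψ X).1 0 = 0 ↔ X.1 0 = 0 := fun X => by
    rw [← mem_isotropy (h0 := hV), ← mem_isotropy (h0 := hU), ← hψ, LieSubalgebra.mem_map]
    constructor
    · rintro ⟨X', hX', e⟩
      rwa [← ψ.injective e]
    · exact fun hX => ⟨X, hX, rfl⟩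
  obtain ⟨σ, e, κ, hσ, -, he, hsplit, -⟩ := hg.exists_splitting
  let τ : g →ₗ⁅ℝ⁆ VectorFieldOn V := g'.incl.comp (ψ : g →ₗ⁅ℝ⁆ g')
  have hinv : (frame g.incl σ 0).IsInvertible := frame_incl_zero hσ
  -- If `ψ (σ c)` vanishes at the origin, then so does `σ c`, whose value there is `c`.
  have hinv' : (frame τ σ 0).IsInvertible := by
    have hinj : Function.Injective (frame τ σ 0 : Plane →ₗ[ℝ] Plane) := by
      refine (injective_iff_map_eq_zero _).2 fun c hc => ?_
      rw [← hσ c]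
      exact (hiso (σ c)).1 hc
    exact ⟨(LinearEquiv.ofInjectiveEndo _ hinj).toContinuousLinearEquiv, by ext <;> rfl⟩
  have hS : transportDomain g.incl V σ ∈ 𝓝 0 := transportDomain_mem_nhds hU hV hinv
  have h00 : (0 : Plane × Plane) ∈ transportDomain g.incl V σ := mem_of_mem_nhds hS
  obtain ⟨f, hf0, hf⟩ := exists_hasFDerivAt_of_integrableAt (F := transport g.incl τ σ)
    (P := fun z => ∀ w, defect g.incl τ σ w z = 0)
    ((contDiffAt_transport h00).of_le (WithTop.coe_le_coe.2 le_top)) hS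
    (fun z hz hP => integrableAt_transport hz hP)
    (fun p q hq hz => hsplit.defect_eq_zero ((hiso e).2 he) he hq hz)
  have hcont : Filter.Tendsto (fun p => (p, f p)) (𝓝 0) (𝓝 0) := by
    have h1 : ContinuousAt f 0 := hf.self_of_nhds.1.continuousAt
    have h2 : ContinuousAt (fun p => (p, f p)) 0 := continuousAt_id.prodMk h1
    have h3 := h2.tendsto
    rwa [hf0] at h3
  have hev := (hf.and (hcont.eventually hS)).and
    (((continuous_snd.tendsto _).comp hcont).eventually (eventually_isInvertible_frame hV hinv'))
  obtain ⟨s, hs, hso, h0s⟩ := eventually_nhds_iff.1 hev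
  have hd : ∀ p ∈ s, HasFDerivAt f (transport g.incl τ σ (p, f p)) p := fun p hp => (hs p hp).1.1.1
  have hm : ∀ p ∈ s, (p, f p) ∈ transportDomain g.incl V σ := fun p hp => (hs p hp).1.2
  obtain ⟨φ, hφ, hφs, hφf⟩ := exists_isLocalDiffeoFixingOrigin (U := U) (V := V) hso h0s hf0
    (fun p hp => (hm p hp).1.1) (fun p hp => (hm p hp).2)
    (contDiffOn_of_hasFDerivAt hso (fun p hp => contDiffAt_transport (hm p hp)) hd)
    (fun p hp => by
      rw [(hd p hp).fderiv]
      refine (hs p hp).2.2.comp ?_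
      obtain ⟨B, hB⟩ := (hm p hp).1.2
      exact ⟨B.symm, by rw [← hB, ContinuousLinearMap.inverse_equiv]⟩)
  refine ⟨φ, hφ, fun X hX => ⟨_, (ψ ⟨X, hX⟩).2, fun p hp => ?_⟩⟩
  rw [hφf, (hd p (hφs hp)).fderiv]
  -- The vanishing defect of `X` at `(p, f p)` is the push-forward relation, as `transport` is the
  -- derivative there.
  exact (sub_eq_zero.1 ((hs p (hφs hp)).1.1.2 ⟨X, hX⟩)).symm

end Pushforward

end PlaneVF

end

theorem mainTheorem5 (U V : TopologicalSpace.Opens PlaneVF.Plane)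
    (hU : (0 : PlaneVF.Plane) ∈ U) (hV : (0 : PlaneVF.Plane) ∈ V)
    (g : LieSubalgebra ℝ (PlaneVF.VectorFieldOn U)) (g' : LieSubalgebra ℝ (PlaneVF.VectorFieldOn V))
    (hg : PlaneVF.IsTransitive3 hU g) (hg' : PlaneVF.IsTransitive3 hV g') :
    ((∃ φ : OpenPartialHomeomorph PlaneVF.Plane PlaneVF.Plane,
        PlaneVF.IsLocalDiffeoFixingOrigin U V φ ∧ ∀ X ∈ g, ∃ Y ∈ g', PlaneVF.PushesTo φ X Y) ↔
      ∃ ψ : g ≃ₗ⁅ℝ⁆ g', (PlaneVF.isotropy hU g).map (ψ : g →ₗ⁅ℝ⁆ g') = PlaneVF.isotropy hV g') ∧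
    (∃ X : g, ∃ X₀ ∈ PlaneVF.isotropy hU g, ⁅X, X₀⁆ ∉ PlaneVF.isotropy hU g) ∧
    (∃ X : g', ∃ X₀ ∈ PlaneVF.isotropy hV g', ⁅X, X₀⁆ ∉ PlaneVF.isotropy hV g') :=
  ⟨⟨fun ⟨_, hφ, h⟩ => PlaneVF.exists_lieEquiv_of_pushesTo hg hg' hφ h,
    fun ⟨ψ, hψ⟩ => PlaneVF.exists_pushesTo_of_lieEquiv hg ψ hψ⟩,
    hg.exists_bracket_notMem_isotropy, hg'.exists_bracket_notMem_isotropy⟩
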